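/- For an integer $n\ge 1$, let $H_{1\times 1\times n}$ (the hexagonal line tiling, a row of $n$ hexagons) be the graph with vertices $v_r^i$ for $i\in\{1,2\}$ and $1\le r\le 2n+1$, and with edges $\{v_r^i,v_{r+1}^i\}$ for $i\in\{1,2\}$, $1\le r\le 2n$, together with $\{v_{2t-1}^1,v_{2t-1}^2\}$ for $1\le t\le n+1$. For a graph $G$, let $\operatorname{Ind}(G)$ be its independence complex, the simplicial complex on the vertex set of $G$ whose faces are the independent sets of vertices (sets containing no two adjacent vertices). Theorem. For every $n\ge 1$, the geometric realization of $\operatorname{Ind}(H_{1\times 1\times n})$ is homotopy equivalent to the wedge of two $n$-dimensional spheres: $$\operatorname{Ind}(H_{1\times 1\times n})\simeq \mathbb{S}^n\vee \mathbb{S}^n .$$ -/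

import Mathlib

/-- The independence complex of a simple graph: its faces are the (nonempty) finite independent
sets of vertices. (Mathlib's abstract simplicial complexes do not list the empty face; this does
not change the geometric realization.) -/
def indComplex {V : Type*} (G : SimpleGraph V) : AbstractSimplicialComplex V where
  faces := {s | s.Nonempty ∧ G.IsIndepSet (s : Set V)}
  isRelLowerSet_faces := by
    intro s hs
    refine ⟨hs.1, fun t hts ht => ⟨ht, ?_⟩⟩
    exact hs.2.mono (by exact_mod_cast hts)
  singleton_mem := by
    intro v
    refine ⟨Finset.singleton_nonempty v, ?_⟩
    simp [SimpleGraph.IsIndepSet]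

/-- The geometric realization of a simplicial complex on a finite vertex set `V`, as a subset of
`ℝ^V`: the union over all faces `s` of the geometric simplices spanned by the standard basis
vectors indexed by `s`, i.e. the points with nonnegative coordinates summing to `1` that vanish
outside some face. It is regarded as a space with the topology induced from `ℝ^V`. -/
def geomRealization {V : Type*} [Fintype V] (K : AbstractSimplicialComplex V) : Set (V → ℝ) :=
  {x | x ∈ stdSimplex ℝ V ∧ ∃ s ∈ K.faces, ∀ v, v ∉ s → x v = 0}

/-- The hexagonal line tiling `H_{1 × 1 × n}`. The vertex written `v_r^i` with `i ∈ {1, 2}` and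
`1 ≤ r ≤ 2n + 1` is the pair `(i - 1, r - 1)`. The edges are the edges `v_r^i v_{r+1}^i`
(`1 ≤ r ≤ 2n`) of the two paths, and the rungs `v_r^1 v_r^2` for odd `r`, i.e. for even
zero-based position `r - 1`. -/
def hexLineTiling (n : ℕ) : SimpleGraph (Fin 2 × Fin (2 * n + 1)) where
  Adj a b :=
    (a.1 = b.1 ∧ (a.2.val + 1 = b.2.val ∨ b.2.val + 1 = a.2.val)) ∨
      (a.1 ≠ b.1 ∧ a.2 = b.2 ∧ Even a.2.val)
  symm := ⟨by
    rintro a b (⟨h, h'⟩ | ⟨h, h', h''⟩)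
    · exact Or.inl ⟨h.symm, h'.symm⟩
    · exact Or.inr ⟨h.symm, h'.symm, h' ▸ h''⟩⟩
  loopless := ⟨by
    rintro a (⟨_, h⟩ | ⟨h, _⟩)
    · omega
    · exact h rfl⟩

/-- The wedge sum of two pointed spaces: the quotient of the disjoint union by the equivalence
relation generated by identifying the two base points, with the quotient topology. -/
abbrev WedgeSum (X Y : Type*) [TopologicalSpace X] [TopologicalSpace Y] (x₀ : X) (y₀ : Y) :
    Type _ :=
  Quot (fun a b : X ⊕ Y => a = Sum.inl x₀ ∧ b = Sum.inr y₀)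

/-- The unit sphere `S^n` in the Euclidean space `ℝ^{n+1}`. -/
abbrev unitSphere (n : ℕ) : Type :=
  Metric.sphere (0 : EuclideanSpace ℝ (Fin (n + 1))) 1

/-- The base point `(1, 0, …, 0)` of `S^n`. -/
noncomputable def unitSphere.base (n : ℕ) : unitSphere n :=
  ⟨EuclideanSpace.single 0 1, by simp⟩

/-! Adding an edge `uv` preserves the homotopy type of an independence complex whenever some other
vertex `w` satisfies N(w) ⊆ N(u) ∪ N(v): the mass min(x_u, x_v) slides linearly from `u` and `v` to
`w`. With `u = v` the move deletes `u`; read backwards it removes an edge. This is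
`nonempty_homotopyEquiv_indepSpace_of_cone`.

Such moves dismantle the strip from its right end. They cut off the last rung and turn the rest of
its hexagon into a triangle on the previous rung; if another hexagon remains to the left, the apex
of the triangle can be deleted as well. So each hexagon yields one isolated edge, and what finally
remains is a triangle and `n` disjoint edges.

The independence complex of that graph is the join of three points with `n` copies of S^0, that is,
three `n`-balls glued along their common boundary S^(n-1). Collapsing one ball to a point leaves S^n
∨ S^n. That this collapse is a homotopy equivalence is shown by an explicit homotopy of the whole
space which contracts that ball and descends to the quotient. -/

open Topology unitInterval

/-! ### Independence complexes and the move that adds an edge -/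

/-- The points of the standard simplex on `V` whose support contains no two `R`-related vertices.
A vertex related to itself is thereby excluded from all supports. -/
def indepSpace {V : Type*} [Fintype V] (R : V → V → Prop) : Set (V → ℝ) :=
  {x | x ∈ stdSimplex ℝ V ∧ ∀ a b, R a b → x a * x b = 0}

/-- A point lies in the simplex of some face exactly when its own support is a face, so membership
reduces to quadratic equations on edges. -/
theorem geomRealization_indComplex {V : Type*} [Fintype V] (G : SimpleGraph V) :
    geomRealization (indComplex G) = indepSpace G.Adj := by
  classical
  ext x
  constructor
  · rintro ⟨hx, s, hs, h⟩
    refine ⟨hx, fun a b hab => ?_⟩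
    by_contra hne
    have ha : a ∈ s := by
      by_contra ha
      exact hne (by simp [h a ha])
    have hb : b ∈ s := by
      by_contra hb
      exact hne (by simp [h b hb])
    exact hs.2 (by exact_mod_cast ha) (by exact_mod_cast hb) hab.ne hab
  · rintro ⟨hx, h⟩
    refine ⟨hx, Finset.univ.filter (fun v => x v ≠ 0), ⟨?_, ?_⟩, ?_⟩
    · by_contra hne
      have h0 : ∀ v, x v = 0 := by
        simpa [Finset.filter_eq_empty_iff] using hne
      have := hx.2
      simp [h0] at this
    · intro a ha b hb _ hab
      simp only [Finset.coe_filter, Finset.mem_univ, true_and, Set.mem_ofPred_eq] at ha hb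
      exact (mul_ne_zero ha hb) (h a b hab)
    · intro v hv
      simpa using hv

/-- A straight-line deformation retraction of a set onto a subset. -/
theorem nonempty_homotopyEquiv_of_segment_subset {E : Type*} [AddCommGroup E] [Module ℝ E]
    [TopologicalSpace E] [ContinuousAdd E] [ContinuousSMul ℝ E] {A B : Set E} (hBA : B ⊆ A)
    (r : E → E) (hr : Continuous r) (hrB : Set.MapsTo r A B) (hfix : ∀ x ∈ B, r x = x)
    (hseg : ∀ x ∈ A, segment ℝ x (r x) ⊆ A) :
    Nonempty (ContinuousMap.HomotopyEquiv A B) := by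
  let f : C(A, B) := ⟨fun x => ⟨r x, hrB x.2⟩, by fun_prop⟩
  let g : C(B, A) := ⟨Set.inclusion hBA, continuous_inclusion hBA⟩
  refine ⟨⟨f, g, ?_, ?_⟩⟩
  · refine ContinuousMap.Homotopic.symm ⟨⟨⟨fun p => ⟨(1 - (p.1 : ℝ)) • (p.2 : E) + (p.1 : ℝ) • r p.2,
      hseg _ p.2.2 ⟨1 - p.1, p.1, by linarith [p.1.2.2], p.1.2.1, by ring, rfl⟩⟩, ?_⟩, ?_, ?_⟩⟩
    · fun_prop
    · intro x
      simp
    · intro x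
      simp [f, g]
  · have : f.comp g = ContinuousMap.id B := by
      ext x
      simp [f, g, hfix x x.2]
    rw [this]

/-- Adding the constraint `x u * x v = 0` does not change the homotopy type, if every set
containing `u` and `v` stays independent when a suitable vertex `w` is added. -/
theorem nonempty_homotopyEquiv_indepSpace_of_cone {V : Type*} [Fintype V]
    {R R' : V → V → Prop} (hsymm : ∀ a b, R a b → R b a) (u v w : V)
    (hR' : ∀ x, x ∈ indepSpace R' ↔ x ∈ indepSpace R ∧ x u * x v = 0)
    (hwu : w ≠ u) (hwv : w ≠ v) (hww : ¬ R w w) (hw : ∀ c, R w c → R u c ∨ R v c) :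
    Nonempty (ContinuousMap.HomotopyEquiv (indepSpace R) (indepSpace R')) := by
  classical
  let m : (V → ℝ) → ℝ := fun x => min (x u) (x v)
  -- The weight at `w` is what `u` and `v` lose together, so the total mass is conserved; it is 1 if
  -- they coincide.
  let d : V → ℝ := fun c =>
    if c = w then (if u = v then 1 else 2) else if c = u ∨ c = v then -1 else 0
  let r : (V → ℝ) → V → ℝ := fun x c => x c + m x * d c
  have hd : ∑ c, d c = 0 := by
    by_cases huv : u = v
    · subst huv
      have : d = fun c => (if c = w then 1 else 0) + (if c = u then -1 else 0) := by
        funext c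
        by_cases h1 : c = w
        · subst h1; simp [d, hwu]
        · by_cases h2 : c = u
          · subst h2; simp [d, h1]
          · simp [d, h1, h2]
      simp [this, Finset.sum_add_distrib]
    · have : d = fun c => (if c = w then 2 else 0) +
          ((if c = u then -1 else 0) + (if c = v then -1 else 0)) := by
        funext c
        by_cases h1 : c = w
        · subst h1; simp [d, hwu, hwv, huv]
        · by_cases h2 : c = u
          · subst h2; simp [d, h1, huv]
          · by_cases h3 : c = v
            · subst h3; simp [d, h1, h2]
            · simp [d, h1, h2, h3]
      simp [this, Finset.sum_add_distrib]
      norm_num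
  have hm0 : ∀ x ∈ indepSpace R, 0 ≤ m x := fun x hx => le_min (hx.1.1 u) (hx.1.1 v)
  have hdge : ∀ c, c ≠ u → c ≠ v → 0 ≤ d c := by
    intro c h1 h2
    by_cases h3 : c = w
    · simp only [d, h3, if_true]; split_ifs <;> norm_num
    · simp [d, h1, h2, h3]
  have hdu : d u = -1 := by simp [d, hwu.symm]
  have hdv : d v = -1 := by simp [d, hwv.symm]
  have hmem : ∀ x ∈ indepSpace R, ∀ s : ℝ, 0 ≤ s → s ≤ 1 →
      (fun c => x c + s * (m x * d c)) ∈ indepSpace R := by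
    intro x hx s hs0 hs1
    have hsm : s * m x ≤ m x := by nlinarith [hm0 x hx]
    refine ⟨⟨fun c => ?_, ?_⟩, ?_⟩
    · by_cases h1 : c = u
      · subst h1
        have : m x ≤ x c := min_le_left _ _
        simp only [hdu]; linarith
      by_cases h2 : c = v
      · subst h2
        have : m x ≤ x c := min_le_right _ _
        simp only [hdv]; linarith
      have := mul_nonneg hs0 (mul_nonneg (hm0 x hx) (hdge c h1 h2))
      have := hx.1.1 c
      simp only; linarith
    · rw [Finset.sum_add_distrib, ← Finset.mul_sum, ← Finset.mul_sum, hd, hx.1.2]; simp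
    -- If `m x = 0` nothing moves. Otherwise `u` and `v` both lie in the support, so every neighbour
    -- of `w` has coordinate zero.
    · by_cases hmx : m x = 0
      · simpa [hmx] using hx.2
      have hu : x u ≠ 0 := fun h => hmx (le_antisymm (h ▸ min_le_left _ _) (hm0 x hx))
      have hv : x v ≠ 0 := fun h => hmx (le_antisymm (h ▸ min_le_right _ _) (hm0 x hx))
      have hzero : ∀ c, c ≠ w → x c = 0 → x c + s * (m x * d c) = 0 := by
        intro c hcw hc
        have h1 : c ≠ u := fun h => hu (h ▸ hc)
        have h2 : c ≠ v := fun h => hv (h ▸ hc)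
        simp [d, h1, h2, hcw, hc]
      have hnbr : ∀ c, R w c → x c + s * (m x * d c) = 0 := by
        intro c hc
        refine hzero c (fun h => hww (h ▸ hc)) ?_
        rcases hw c hc with h | h
        · exact (mul_eq_zero.mp (hx.2 _ _ h)).resolve_left hu
        · exact (mul_eq_zero.mp (hx.2 _ _ h)).resolve_left hv
      intro a b hab
      beta_reduce
      by_cases ha : a = w
      · rw [hnbr b (ha ▸ hab), mul_zero]
      by_cases hb : b = w
      · rw [hnbr a (hsymm _ _ (hb ▸ hab)), zero_mul]
      rcases mul_eq_zero.mp (hx.2 a b hab) with h | h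
      · rw [hzero a ha h, zero_mul]
      · rw [hzero b hb h, mul_zero]
  refine nonempty_homotopyEquiv_of_segment_subset (r := r) (fun x hx => ((hR' x).1 hx).1) ?_ ?_ ?_ ?_
  · fun_prop
  · intro x hx
    refine (hR' _).2 ⟨by simpa using hmem x hx 1 zero_le_one le_rfl, ?_⟩
    simp only [r, hdu, hdv, m]
    rcases min_choice (x u) (x v) with h | h <;> rw [h] <;> simp
  · intro x hx
    obtain ⟨h1, h2⟩ := (hR' x).1 hx
    have : m x = 0 := by
      refine le_antisymm ?_ (hm0 x h1)
      rcases mul_eq_zero.mp h2 with h | h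
      · exact h ▸ min_le_left _ _
      · exact h ▸ min_le_right _ _
    funext c
    simp [r, this]
  · rintro x hx y ⟨s, t, hs, ht, hst, rfl⟩
    convert hmem x hx t ht (by linarith) using 1
    funext c
    obtain rfl : s = 1 - t := by linarith
    simp only [r, Pi.add_apply, Pi.smul_apply, smul_eq_mul]
    ring

/-! ### Dismantling the strip to a triangle and disjoint edges -/

/-- The relation on `Fin 2 × Fin m` induced by a relation on pairs of natural numbers. -/
def gridRel (m : ℕ) (ρ : ℕ → ℕ → ℕ → ℕ → Prop) (a b : Fin 2 × Fin m) : Prop :=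
  ρ a.1 a.2 b.1 b.2

/-- Coordinates in ℕ make the neighbourhood conditions a matter of linear arithmetic. -/
theorem nonempty_homotopyEquiv_gridRel_of_cone {m : ℕ} {ρ ρ' : ℕ → ℕ → ℕ → ℕ → Prop}
    (ui up vi vp wi wp : ℕ) (hui : ui < 2) (hvi : vi < 2) (hwi : wi < 2) (hup : up < m)
    (hvp : vp < m) (hwp : wp < m)
    (hρ' : ∀ i p j q, ρ' i p j q ↔
      ρ i p j q ∨ (i = ui ∧ p = up ∧ j = vi ∧ q = vp) ∨ (i = vi ∧ p = vp ∧ j = ui ∧ q = up))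
    (hsymm : ∀ i p j q, ρ i p j q → ρ j q i p)
    (hwu : ¬ (wi = ui ∧ wp = up)) (hwv : ¬ (wi = vi ∧ wp = vp)) (hww : ¬ ρ wi wp wi wp)
    (hw : ∀ j q, j < 2 → ρ wi wp j q → ρ ui up j q ∨ ρ vi vp j q) :
    Nonempty (ContinuousMap.HomotopyEquiv (indepSpace (gridRel m ρ))
      (indepSpace (gridRel m ρ'))) := by
  refine nonempty_homotopyEquiv_indepSpace_of_cone (fun a b h => hsymm _ _ _ _ h)
    (⟨ui, hui⟩, ⟨up, hup⟩) (⟨vi, hvi⟩, ⟨vp, hvp⟩) (⟨wi, hwi⟩, ⟨wp, hwp⟩) ?_ ?_ ?_ hww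
    (fun c h => hw _ _ c.1.2 h)
  · intro x
    constructor
    · rintro ⟨h1, h2⟩
      exact ⟨⟨h1, fun a b h => h2 a b ((hρ' _ _ _ _).2 (Or.inl h))⟩,
        h2 _ _ ((hρ' _ _ _ _).2 (Or.inr (Or.inl ⟨rfl, rfl, rfl, rfl⟩)))⟩
    · rintro ⟨⟨h1, h2⟩, h3⟩
      refine ⟨h1, ?_⟩
      rintro ⟨⟨i, hi⟩, ⟨p, hp⟩⟩ ⟨⟨j, hj⟩, ⟨q, hq⟩⟩ h
      rcases (hρ' _ _ _ _).1 h with h | ⟨rfl, rfl, rfl, rfl⟩ | ⟨rfl, rfl, rfl, rfl⟩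
      · exact h2 _ _ h
      · exact h3
      · rw [mul_comm]; exact h3
  · simpa using hwu
  · simpa using hwv

/-- The paths run up to position `2 * k`, all rungs are present, and the vertices at odd positions
beyond `2 * k` are excluded. -/
def partialTiling (k i p j q : ℕ) : Prop :=
  (i = j ∧ (p + 1 = q ∨ q + 1 = p) ∧ p ≤ 2 * k ∧ q ≤ 2 * k) ∨ (i ≠ j ∧ p = q ∧ p % 2 = 0) ∨
    (i = j ∧ p = q ∧ p % 2 = 1 ∧ 2 * k < p)

theorem partialTiling_symm {k i p j q : ℕ} (h : partialTiling k i p j q) :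
    partialTiling k j q i p := by
  simp only [partialTiling] at h ⊢
  omega

/-- `partialTiling k` with a triangle attached to the rung at position `2 * k`: its third vertex is
`(0, 2 * k + 1)`, and `(1, 2 * k + 1)` is excluded. The relation also lists some
pairs containing the excluded vertex. -/
def triangleTiling (k i p j q : ℕ) : Prop :=
  (partialTiling (k + 1) i p j q ∧
      ¬ (i = 0 ∧ j = 0 ∧ 2 * k + 1 ≤ p ∧ 2 * k + 1 ≤ q ∧ p + q = 4 * k + 3)) ∨
    (i ≠ j ∧ ((p = 2 * k ∧ q = 2 * k + 1) ∨ (p = 2 * k + 1 ∧ q = 2 * k))) ∨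
    (i = 1 ∧ j = 1 ∧ p = 2 * k + 1 ∧ q = 2 * k + 1)

/-- The last hexagon is opened in four moves: add its two diagonals next to the rung at `2 * k`,
then remove one edge to the last rung, then one vertex. -/
theorem nonempty_homotopyEquiv_partialTiling_triangleTiling {m k : ℕ} (hk : 2 * k + 2 < m) :
    Nonempty (ContinuousMap.HomotopyEquiv (indepSpace (gridRel m (partialTiling (k + 1))))
      (indepSpace (gridRel m (triangleTiling k)))) := by
  let ρ₁ : ℕ → ℕ → ℕ → ℕ → Prop := fun i p j q => partialTiling (k + 1) i p j q ∨
    (i = 0 ∧ p = 2 * k ∧ j = 1 ∧ q = 2 * k + 1) ∨ (i = 1 ∧ p = 2 * k + 1 ∧ j = 0 ∧ q = 2 * k)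
  let ρ₂ : ℕ → ℕ → ℕ → ℕ → Prop := fun i p j q => ρ₁ i p j q ∨
    (i = 1 ∧ p = 2 * k ∧ j = 0 ∧ q = 2 * k + 1) ∨ (i = 0 ∧ p = 2 * k + 1 ∧ j = 1 ∧ q = 2 * k)
  let ρ₃ : ℕ → ℕ → ℕ → ℕ → Prop := fun i p j q => ρ₂ i p j q ∧
      ¬ (i = 0 ∧ j = 0 ∧ 2 * k + 1 ≤ p ∧ 2 * k + 1 ≤ q ∧ p + q = 4 * k + 3)
  let ρ₄ : ℕ → ℕ → ℕ → ℕ → Prop := fun i p j q => ρ₃ i p j q ∨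
    (i = 1 ∧ p = 2 * k + 1 ∧ j = 1 ∧ q = 2 * k + 1) ∨
    (i = 1 ∧ p = 2 * k + 1 ∧ j = 1 ∧ q = 2 * k + 1)
  -- The only neighbours of `(0, 2 * k + 2)` are `(0, 2 * k + 1)` and `(1, 2 * k + 2)`; each is
  -- adjacent to one end of the new diagonal. `e₂` is the mirror image.
  obtain ⟨e₁⟩ := nonempty_homotopyEquiv_gridRel_of_cone (m := m) (ρ := partialTiling (k + 1))
    (ρ' := ρ₁) 0 (2 * k) 1 (2 * k + 1) 0 (2 * k + 2)
    (by omega) (by omega) (by omega) (by omega) (by omega) (by omega) (fun _ _ _ _ => Iff.rfl)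
    (fun _ _ _ _ => partialTiling_symm) (by omega) (by omega)
    (by simp only [partialTiling]; grind) (by simp only [partialTiling]; grind)
  obtain ⟨e₂⟩ := nonempty_homotopyEquiv_gridRel_of_cone (m := m) (ρ := ρ₁)
    (ρ' := ρ₂) 1 (2 * k) 0 (2 * k + 1) 1 (2 * k + 2)
    (by omega) (by omega) (by omega) (by omega) (by omega) (by omega) (fun _ _ _ _ => Iff.rfl)
    (by simp only [ρ₁]; grind [partialTiling_symm]) (by omega) (by omega)
    (by simp only [ρ₁, partialTiling]; grind) (by simp only [ρ₁, partialTiling]; grind)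
  -- This move is used backwards. Of the neighbours of `(1, 2 * k + 1)`, the diagonals make both
  -- rung ends at `2 * k` adjacent to `(0, 2 * k + 1)`, and `(1, 2 * k + 2)` is adjacent to `(0, 2 *
  -- k + 2)`.
  obtain ⟨e₃⟩ := nonempty_homotopyEquiv_gridRel_of_cone (m := m) (ρ := ρ₃)
    (ρ' := ρ₂) 0 (2 * k + 1) 0 (2 * k + 2) 1 (2 * k + 1)
    (by omega) (by omega) (by omega) (by omega) (by omega) (by omega)
    (by
      intro i p j q
      by_cases hb : i = 0 ∧ j = 0 ∧ 2 * k + 1 ≤ p ∧ 2 * k + 1 ≤ q ∧ p + q = 4 * k + 3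
      · have h : ρ₂ i p j q := Or.inl (Or.inl (Or.inl (by omega)))
        exact ⟨fun _ => Or.inr (by omega), fun _ => h⟩
      · simp only [ρ₃, hb]
        constructor
        · exact fun h => Or.inl ⟨h, not_false⟩
        · rintro (h | h)
          · exact h.1
          · omega)
    (by simp only [ρ₃, ρ₂, ρ₁]; grind [partialTiling_symm]) (by omega) (by omega)
    (by simp only [ρ₃, ρ₂, ρ₁, partialTiling]; grind)
    (by simp only [ρ₃, ρ₂, ρ₁, partialTiling]; grind)
  -- Now `(0, 2 * k + 1)` sees only the rung at `2 * k`, whose ends are also neighbours of `(1, 2 *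
  -- k + 1)`; the latter is deleted by a loop.
  obtain ⟨e₄⟩ := nonempty_homotopyEquiv_gridRel_of_cone (m := m) (ρ := ρ₃)
    (ρ' := ρ₄) 1 (2 * k + 1) 1 (2 * k + 1) 0 (2 * k + 1)
    (by omega) (by omega) (by omega) (by omega) (by omega) (by omega) (fun _ _ _ _ => Iff.rfl)
    (by simp only [ρ₃, ρ₂, ρ₁]; grind [partialTiling_symm]) (by omega) (by omega)
    (by simp only [ρ₃, ρ₂, ρ₁, partialTiling]; grind)
    (by simp only [ρ₃, ρ₂, ρ₁, partialTiling]; grind)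
  have h : gridRel m ρ₄ = gridRel m (triangleTiling k) := by
    funext ⟨⟨i, hi⟩, ⟨p, hp⟩⟩ ⟨⟨j, hj⟩, ⟨q, hq⟩⟩
    refine propext ?_
    simp only [gridRel, ρ₄, ρ₃, ρ₂, ρ₁, triangleTiling]
    grind
  rw [← h]
  exact ⟨((e₁.trans e₂).trans e₃.symm).trans e₄⟩

/-- A hexagon to the left makes the apex `(0, 2 * k + 3)` redundant: once joined to `(1, 2 * k)`, it
is adjacent to both neighbours of `(1, 2 * k + 1)`. The index `k + 1` ensures that such a hexagon
exists. -/
theorem nonempty_homotopyEquiv_triangleTiling_partialTiling {m k : ℕ} (hk : 2 * k + 4 < m) :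
    Nonempty (ContinuousMap.HomotopyEquiv (indepSpace (gridRel m (triangleTiling (k + 1))))
      (indepSpace (gridRel m (partialTiling (k + 1))))) := by
  let ρ₁ : ℕ → ℕ → ℕ → ℕ → Prop := fun i p j q => triangleTiling (k + 1) i p j q ∨
    (i = 0 ∧ p = 2 * k + 3 ∧ j = 1 ∧ q = 2 * k) ∨ (i = 1 ∧ p = 2 * k ∧ j = 0 ∧ q = 2 * k + 3)
  let ρ₂ : ℕ → ℕ → ℕ → ℕ → Prop := fun i p j q => ρ₁ i p j q ∨
    (i = 0 ∧ p = 2 * k + 3 ∧ j = 0 ∧ q = 2 * k + 3) ∨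
    (i = 0 ∧ p = 2 * k + 3 ∧ j = 0 ∧ q = 2 * k + 3)
  obtain ⟨e₁⟩ := nonempty_homotopyEquiv_gridRel_of_cone (m := m) (ρ := triangleTiling (k + 1))
    (ρ' := ρ₁) 0 (2 * k + 3) 1 (2 * k) 0 (2 * k + 1)
    (by omega) (by omega) (by omega) (by omega) (by omega) (by omega) (fun _ _ _ _ => Iff.rfl)
    (by simp only [triangleTiling]; grind [partialTiling_symm]) (by omega) (by omega)
    (by simp only [triangleTiling, partialTiling]; grind)
    (by simp only [triangleTiling, partialTiling]; grind)
  obtain ⟨e₂⟩ := nonempty_homotopyEquiv_gridRel_of_cone (m := m) (ρ := ρ₁)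
    (ρ' := ρ₂) 0 (2 * k + 3) 0 (2 * k + 3) 1 (2 * k + 1)
    (by omega) (by omega) (by omega) (by omega) (by omega) (by omega) (fun _ _ _ _ => Iff.rfl)
    (by simp only [ρ₁, triangleTiling]; grind [partialTiling_symm]) (by omega) (by omega)
    (by simp only [ρ₁, triangleTiling, partialTiling]; grind)
    (by simp only [ρ₁, triangleTiling, partialTiling]; grind)
  -- The relations differ, but only in pairs meeting column `2 * k + 3`, whose vertices both carry
  -- loops.
  have h : indepSpace (gridRel m ρ₂) = indepSpace (gridRel m (partialTiling (k + 1))) := by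
    ext x
    constructor
    · rintro ⟨h1, h2⟩
      refine ⟨h1, fun a b hab => ?_⟩
      by_cases ha : (a.2 : ℕ) = 2 * k + 3
      · have := h2 a a (by
          simp only [gridRel, ρ₂, ρ₁, triangleTiling, partialTiling] at hab ⊢; grind)
        rw [mul_self_eq_zero.mp this, zero_mul]
      · refine h2 a b ?_
        simp only [gridRel, ρ₂, ρ₁, triangleTiling, partialTiling] at hab ⊢; grind
    · rintro ⟨h1, h2⟩
      refine ⟨h1, fun a b hab => ?_⟩
      by_cases ha : (a.2 : ℕ) = 2 * k + 3
      · have := h2 a a (by simp only [gridRel, partialTiling]; grind)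
        rw [mul_self_eq_zero.mp this, zero_mul]
      by_cases hb : (b.2 : ℕ) = 2 * k + 3
      · have := h2 b b (by simp only [gridRel, partialTiling]; grind)
        rw [mul_self_eq_zero.mp this, mul_zero]
      refine h2 a b ?_
      simp only [gridRel, ρ₂, ρ₁, triangleTiling, partialTiling] at hab ⊢; grind
  rw [← h]
  exact ⟨e₁.trans e₂⟩

theorem nonempty_homotopyEquiv_partialTiling_triangleTiling_zero {m : ℕ} (k : ℕ)
    (hk : 2 * k + 2 < m) :
    Nonempty (ContinuousMap.HomotopyEquiv (indepSpace (gridRel m (partialTiling (k + 1))))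
      (indepSpace (gridRel m (triangleTiling 0)))) := by
  induction k with
  | zero => exact nonempty_homotopyEquiv_partialTiling_triangleTiling hk
  | succ k ih =>
    obtain ⟨e₁⟩ := nonempty_homotopyEquiv_partialTiling_triangleTiling hk
    obtain ⟨e₂⟩ := nonempty_homotopyEquiv_triangleTiling_partialTiling (m := m) (k := k) (by omega)
    obtain ⟨e₃⟩ := ih (by omega)
    exact ⟨(e₁.trans e₂).trans e₃⟩

theorem hexLineTiling_adj_eq (n : ℕ) :
    (hexLineTiling n).Adj = gridRel (2 * n + 1) (partialTiling n) := by
  funext ⟨⟨i, hi⟩, ⟨p, hp⟩⟩ ⟨⟨j, hj⟩, ⟨q, hq⟩⟩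
  refine propext ?_
  simp only [hexLineTiling, gridRel, partialTiling, Nat.even_iff, Fin.mk.injEq, ne_eq]
  omega

/-! ### Homotopies descending to quotients, and wedges as pairs of axes -/

/-- The end map of `H` factors through `f` to give the inverse, and `H` itself descends to a
homotopy on `W`. -/
theorem nonempty_homotopyEquiv_of_compatible_homotopy {X W : Type*} [TopologicalSpace X]
    [TopologicalSpace W] [CompactSpace X] [T2Space W] (f : C(X, W))
    (hf : Function.Surjective f) (H : C(I × X, X)) (h0 : ∀ x, H (0, x) = x)
    (h1 : ∀ x x', f x = f x' → H (1, x) = H (1, x'))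
    (hH : ∀ s x x', f x = f x' → f (H (s, x)) = f (H (s, x'))) :
    Nonempty (ContinuousMap.HomotopyEquiv X W) := by
  have hq : IsQuotientMap f := f.continuous.isClosedMap.isQuotientMap f.continuous hf
  let F : C(I × X, I × W) := (ContinuousMap.id I).prodMap f
  -- A product with a quotient map need not be a quotient map; here compactness and the Hausdorff
  -- property make it closed.
  have hF : IsQuotientMap F := by
    have : CompactSpace W := hf.compactSpace f.continuous
    refine F.continuous.isClosedMap.isQuotientMap F.continuous ?_
    rintro ⟨s, w⟩
    obtain ⟨x, rfl⟩ := hf w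
    exact ⟨(s, x), rfl⟩
  let H₁ : C(X, X) := H.comp ⟨fun x => (1, x), by fun_prop⟩
  let g : C(W, X) := hq.lift H₁ h1
  have hg : ∀ x, g (f x) = H (1, x) := fun x => DFunLike.congr_fun (hq.lift_comp H₁ h1) x
  have hfH : ∀ a b, F a = F b → (f.comp H) a = (f.comp H) b := by
    rintro ⟨s, x⟩ ⟨s', x'⟩ h
    obtain rfl : s = s' := congrArg Prod.fst h
    exact hH _ _ _ (congrArg Prod.snd h)
  let K : C(I × W, W) := hF.lift (f.comp H) hfH
  have hK : ∀ s x, K (s, f x) = f (H (s, x)) := fun s x =>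
    DFunLike.congr_fun (hF.lift_comp (f.comp H) hfH) (s, x)
  refine ⟨⟨f, g, ContinuousMap.Homotopic.symm ⟨⟨H, h0, fun x => (hg x).symm⟩⟩,
    ContinuousMap.Homotopic.symm ⟨⟨K, ?_, ?_⟩⟩⟩⟩
  · intro w
    obtain ⟨x, rfl⟩ := hf w
    change K (0, f x) = f x
    rw [hK, h0]
  · intro w
    obtain ⟨x, rfl⟩ := hf w
    change K (1, f x) = f (g (f x))
    rw [hK, hg]

theorem nonempty_wedgeSum_homeomorph {X Y : Type*} [TopologicalSpace X] [TopologicalSpace Y]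
    [CompactSpace X] [CompactSpace Y] [T2Space X] [T2Space Y] (x₀ : X) (y₀ : Y) :
    Nonempty (WedgeSum X Y x₀ y₀ ≃ₜ {p : X × Y | p.1 = x₀ ∨ p.2 = y₀}) := by
  let j : X ⊕ Y → {p : X × Y | p.1 = x₀ ∨ p.2 = y₀} :=
    Sum.elim (fun x => ⟨(x, y₀), Or.inr rfl⟩) (fun y => ⟨(x₀, y), Or.inl rfl⟩)
  have hj : ∀ a b : X ⊕ Y, (a = Sum.inl x₀ ∧ b = Sum.inr y₀) → j a = j b := by
    rintro _ _ ⟨rfl, rfl⟩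
    rfl
  have hjc : Continuous j := by
    refine Continuous.sumElim ?_ ?_ <;> fun_prop
  let k : WedgeSum X Y x₀ y₀ → {p : X × Y | p.1 = x₀ ∨ p.2 = y₀} := Quot.lift j hj
  have hk : Continuous k := continuous_quot_lift hj hjc
  have hinj : Function.Injective k := by
    have hglue : (Quot.mk _ (Sum.inl x₀) : WedgeSum X Y x₀ y₀) = Quot.mk _ (Sum.inr y₀) :=
      Quot.sound ⟨rfl, rfl⟩
    rintro ⟨a⟩ ⟨b⟩ h
    have h : j a = j b := h
    rcases a with a | a <;> rcases b with b | b <;>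
      simp only [j, Sum.elim_inl, Sum.elim_inr, Subtype.mk.injEq, Prod.mk.injEq] at h
    · rw [h.1]
    · rw [h.1, ← h.2]; exact hglue
    · rw [← h.1, h.2]; exact hglue.symm
    · rw [h.2]
  have hsurj : Function.Surjective k := by
    rintro ⟨⟨x, y⟩, rfl | rfl⟩
    · exact ⟨Quot.mk _ (Sum.inr y), rfl⟩
    · exact ⟨Quot.mk _ (Sum.inl x), rfl⟩
  exact ⟨Continuous.homeoOfEquivCompactToT2 (f := Equiv.ofBijective k ⟨hinj, hsurj⟩) hk⟩

/-! ### Three balls with common boundary, and the collapse of one of them -/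

/-- Three `n`-dimensional cross-polytopes glued along their boundary: the points `(y, t)` with
`t` having at most one nonzero coordinate and `∑ |y j| + ∑ t i = 1`. -/
def tripleBall (n : ℕ) : Set ((Fin n → ℝ) × (Fin 3 → ℝ)) :=
  {z | (∀ i, 0 ≤ z.2 i) ∧ (∀ i j, i ≠ j → z.2 i * z.2 j = 0) ∧
    ∑ j, |z.1 j| + ∑ i, z.2 i = 1}

theorem isCompact_tripleBall (n : ℕ) : IsCompact (tripleBall n) := by
  have hclosed : IsClosed (tripleBall n) := by
    simp only [tripleBall, Set.ofPred_and, Set.ofPred_forall]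
    refine (isClosed_iInter fun i => ?_).inter ((isClosed_iInter fun i => isClosed_iInter
      fun j => isClosed_iInter fun _ => ?_).inter ?_)
    · exact isClosed_le (by fun_prop) (by fun_prop)
    · exact isClosed_eq (by fun_prop) (by fun_prop)
    · exact isClosed_eq (by fun_prop) (by fun_prop)
  refine Metric.isCompact_of_isClosed_isBounded hclosed
    ((Metric.isBounded_closedBall (x := 0) (r := 1)).subset ?_)
  rintro z ⟨h1, -, h3⟩
  have hy : 0 ≤ ∑ j, |z.1 j| := Finset.sum_nonneg fun _ _ => abs_nonneg _
  have ht : 0 ≤ ∑ i, z.2 i := Finset.sum_nonneg fun _ _ => h1 _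
  rw [mem_closedBall_zero_iff, Prod.norm_def]
  refine max_le ((pi_norm_le_iff_of_nonneg zero_le_one).2 fun j => ?_)
    ((pi_norm_le_iff_of_nonneg zero_le_one).2 fun i => ?_)
  · have := Finset.single_le_sum (f := fun j => |z.1 j|) (fun _ _ => abs_nonneg _)
      (Finset.mem_univ j)
    simp only [Real.norm_eq_abs] at *
    linarith
  · have := Finset.single_le_sum (f := fun i => z.2 i) (fun _ _ => h1 _) (Finset.mem_univ i)
    rw [Real.norm_of_nonneg (h1 i)]
    linarith

/-- The sum of the squares of all coordinates. -/
def sqSum {n : ℕ} (z : (Fin n → ℝ) × (Fin 3 → ℝ)) : ℝ := ∑ j, z.1 j ^ 2 + ∑ i, z.2 i ^ 2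

theorem sqSum_pos {n : ℕ} {z : (Fin n → ℝ) × (Fin 3 → ℝ)} (hz : z ∈ tripleBall n) :
    0 < sqSum z := by
  have h1 : 0 ≤ ∑ j, z.1 j ^ 2 := Finset.sum_nonneg fun _ _ => sq_nonneg _
  have h2 : 0 ≤ ∑ i, z.2 i ^ 2 := Finset.sum_nonneg fun _ _ => sq_nonneg _
  refine lt_of_le_of_ne (add_nonneg h1 h2) fun h => ?_
  have h3 : ∑ j, z.1 j ^ 2 = 0 := by unfold sqSum at h; linarith
  have h4 : ∑ i, z.2 i ^ 2 = 0 := by unfold sqSum at h; linarith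
  rw [Finset.sum_eq_zero_iff_of_nonneg fun _ _ => sq_nonneg _] at h3 h4
  have h5 : ∀ j, z.1 j = 0 := fun j => by simpa using h3 j (Finset.mem_univ j)
  have h6 : ∀ j, z.2 j = 0 := fun j => by simpa using h4 j (Finset.mem_univ j)
  have := hz.2.2
  simp [h5, h6] at this

theorem tripleBall_eq_zero_of_ne {n : ℕ} {z : (Fin n → ℝ) × (Fin 3 → ℝ)} (hz : z ∈ tripleBall n)
    {i : Fin 3} (hi : z.2 i ≠ 0) (k : Fin 3) (hk : k ≠ i) : z.2 k = 0 :=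
  (mul_eq_zero.mp (hz.2.1 k i hk)).resolve_right hi

/-- The collapse of `tripleBall n` onto a sphere that sends everything but the interior of the
`i`-th cross-polytope to the base point. -/
noncomputable def collapse {n : ℕ} (i : Fin 3) (z : tripleBall n) : unitSphere n :=
  -- For `t i ≠ 0` this is inverse stereographic projection, from the base point, of `y / t i`; the
  -- homogeneous form extends to `t i = 0`.
  ⟨WithLp.toLp 2 (Fin.cons (1 - 2 * z.1.2 i ^ 2 / sqSum z.1)
    fun j => 2 * z.1.2 i * z.1.1 j / sqSum z.1), by
    have hP := sqSum_pos z.2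
    have key : z.1.2 i ^ 2 * sqSum z.1 = z.1.2 i ^ 2 * (∑ j, z.1.1 j ^ 2 + z.1.2 i ^ 2) := by
      by_cases hi : z.1.2 i = 0
      · simp [hi]
      · have : ∑ k, z.1.2 k ^ 2 = z.1.2 i ^ 2 := Finset.sum_eq_single i
          (fun k _ hk => by simp [tripleBall_eq_zero_of_ne z.2 hi k hk]) (by simp)
        rw [sqSum, this]
    rw [mem_sphere_zero_iff_norm, EuclideanSpace.norm_eq, Real.sqrt_eq_one, Fin.sum_univ_succ]
    simp only [Fin.cons_zero, Fin.cons_succ, Real.norm_eq_abs, sq_abs, div_pow, mul_pow]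
    rw [← Finset.sum_div, ← Finset.mul_sum]
    field_simp
    linear_combination (-4 : ℝ) * key⟩

theorem collapse_zero {n : ℕ} (i : Fin 3) (z : tripleBall n) :
    (collapse i z).1 0 = 1 - 2 * z.1.2 i ^ 2 / sqSum z.1 := rfl

theorem collapse_succ {n : ℕ} (i : Fin 3) (z : tripleBall n) (j : Fin n) :
    (collapse i z).1 j.succ = 2 * z.1.2 i * z.1.1 j / sqSum z.1 := rfl

theorem continuous_collapse {n : ℕ} (i : Fin 3) : Continuous (collapse (n := n) i) := by
  have hS : Continuous fun z : tripleBall n => sqSum z.1 := by unfold sqSum; fun_prop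
  have hne : ∀ z : tripleBall n, sqSum z.1 ≠ 0 := fun z => (sqSum_pos z.2).ne'
  refine Continuous.subtype_mk ((PiLp.continuous_toLp 2 _).comp (continuous_pi fun k => ?_)) _
  refine Fin.cases ?_ (fun j => ?_) k
  · simp only [Fin.cons_zero]
    fun_prop (disch := exact hne)
  · simp only [Fin.cons_succ]
    fun_prop (disch := exact hne)

theorem unitSphere_ext {n : ℕ} {p q : unitSphere n} (h0 : p.1 0 = q.1 0)
    (h : ∀ j : Fin n, p.1 j.succ = q.1 j.succ) : p = q := by
  ext k
  exact Fin.cases h0 h k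

theorem collapse_eq_base_iff {n : ℕ} (i : Fin 3) (z : tripleBall n) :
    collapse i z = unitSphere.base n ↔ z.1.2 i = 0 := by
  have hP := sqSum_pos z.2
  constructor
  · intro h
    have h := congrArg (fun p : unitSphere n => p.1 0) h
    simp only [collapse_zero, unitSphere.base, PiLp.single_apply, if_true] at h
    have h : 2 * z.1.2 i ^ 2 / sqSum z.1 = 0 := by linarith
    simpa [hP.ne'] using h
  · intro h
    refine unitSphere_ext ?_ fun j => ?_
    · simp [collapse_zero, h, unitSphere.base]
    · simp [collapse_succ, h, unitSphere.base]

/-- The image determines the ratio `y / t i`, and the normalisation `∑ |y j| + t i = 1` then fixes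
the point. -/
theorem eq_of_collapse_eq {n : ℕ} (i : Fin 3) {z z' : tripleBall n}
    (h : collapse i z = collapse i z') (hi : z.1.2 i ≠ 0) : z = z' := by
  have hi' : z'.1.2 i ≠ 0 := by
    rwa [Ne, ← collapse_eq_base_iff, ← h, collapse_eq_base_iff]
  have hP := (sqSum_pos z.2).ne'
  have hP' := (sqSum_pos z'.2).ne'
  have h0 := congrArg (fun p : unitSphere n => p.1 0) h
  have hs := fun j : Fin n => congrArg (fun p : unitSphere n => p.1 j.succ) h
  simp only [collapse_zero, collapse_succ] at h0 hs
  have h0 : z.1.2 i ^ 2 * sqSum z'.1 = z'.1.2 i ^ 2 * sqSum z.1 := by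
    field_simp at h0
    linarith
  have hy : ∀ j, z.1.1 j * z'.1.2 i = z'.1.1 j * z.1.2 i := by
    intro j
    have := hs j
    field_simp at this
    have h2 : z.1.2 i * sqSum z'.1 ≠ 0 := mul_ne_zero hi hP'
    refine mul_left_cancel₀ h2 ?_
    have h3 : z'.1.2 i * (z.1.2 i * z.1.1 j * sqSum z'.1)
        = z'.1.2 i * (z'.1.2 i * z'.1.1 j * sqSum z.1) := by
      congr 1; linarith
    linear_combination h3 - z'.1.1 j * h0
  have hone : ∀ z : tripleBall n, z.1.2 i ≠ 0 → ∑ j, |z.1.1 j| = 1 - z.1.2 i := by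
    intro z hi
    have : ∑ k, z.1.2 k = z.1.2 i := Finset.sum_eq_single i
      (fun k _ hk => tripleBall_eq_zero_of_ne z.2 hi k hk) (by simp)
    have := z.2.2.2
    linarith
  have ht : z.1.2 i = z'.1.2 i := by
    have h1 : (∑ j, |z.1.1 j|) * z'.1.2 i = (∑ j, |z'.1.1 j|) * z.1.2 i := by
      rw [Finset.sum_mul, Finset.sum_mul]
      refine Finset.sum_congr rfl fun j _ => ?_
      rw [← abs_of_nonneg (z.2.1 i), ← abs_of_nonneg (z'.2.1 i), ← abs_mul, ← abs_mul, hy]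
    rw [hone z hi, hone z' hi'] at h1
    linarith
  refine Subtype.ext (Prod.ext (funext fun j => ?_) (funext fun k => ?_))
  · have := hy j
    rw [ht] at this
    exact mul_right_cancel₀ hi' this
  · by_cases hk : k = i
    · rw [hk, ht]
    · rw [tripleBall_eq_zero_of_ne z.2 hi k hk, tripleBall_eq_zero_of_ne z'.2 hi' k hk]

theorem exists_collapse_eq {n : ℕ} (i : Fin 3) {p : unitSphere n} (hp : p ≠ unitSphere.base n) :
    ∃ z : tripleBall n, collapse i z = p ∧ ∀ k, k ≠ i → z.1.2 k = 0 := by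
  have hnorm : p.1 0 ^ 2 + ∑ j : Fin n, p.1 j.succ ^ 2 = 1 := by
    have := p.2
    rw [mem_sphere_zero_iff_norm, EuclideanSpace.norm_eq, Real.sqrt_eq_one, Fin.sum_univ_succ]
      at this
    simpa using this
  have hw : 0 ≤ ∑ j : Fin n, p.1 j.succ ^ 2 := Finset.sum_nonneg fun _ _ => sq_nonneg _
  have hc : p.1 0 < 1 := by
    refine lt_of_le_of_ne (by nlinarith) fun h => hp ?_
    rw [h] at hnorm
    have h3 : ∑ j : Fin n, p.1 j.succ ^ 2 = 0 := by linarith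
    rw [Finset.sum_eq_zero_iff_of_nonneg fun _ _ => sq_nonneg _] at h3
    refine unitSphere_ext ?_ fun j => ?_
    · simp [h, unitSphere.base]
    · simpa [unitSphere.base] using h3 j (Finset.mem_univ j)
  set c := p.1 0
  have hN : 0 ≤ ∑ j : Fin n, |p.1 j.succ| := Finset.sum_nonneg fun _ _ => abs_nonneg _
  -- Stereographic projection gives the ratio `y : t i` as `p' : 1 - c`, with `p'` the remaining
  -- coordinates; `D` is its ℓ¹-norm.
  obtain ⟨D, hD⟩ : ∃ D, D = 1 - c + ∑ j : Fin n, |p.1 j.succ| := ⟨_, rfl⟩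
  have hDpos : 0 < D := by linarith
  have hc' : 1 - c ≠ 0 := by linarith
  let z : (Fin n → ℝ) × (Fin 3 → ℝ) := (fun j => p.1 j.succ / D, Pi.single i ((1 - c) / D))
  have hz : z ∈ tripleBall n := by
    refine ⟨fun k => ?_, fun k l hkl => ?_, ?_⟩
    · by_cases hk : k = i
      · subst hk
        simp only [z, Pi.single_eq_same]
        exact div_nonneg (by linarith) hDpos.le
      · simp [z, hk]
    · by_cases hk : k = i
      · have hl : l ≠ i := fun h => hkl (hk.trans h.symm)
        simp [z, hl]
      · simp [z, hk]
    · simp only [z, abs_div, abs_of_pos hDpos, Finset.sum_pi_single', Finset.mem_univ, if_true]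
      rw [← Finset.sum_div]
      field_simp
      linarith
  have hS : sqSum z = 2 * (1 - c) / D ^ 2 := by
    have : ∑ k, z.2 k ^ 2 = ((1 - c) / D) ^ 2 := by
      rw [Finset.sum_eq_single i (fun k _ hk => by simp [z, hk]) (by simp)]
      simp [z]
    rw [sqSum, this]
    simp only [z, div_pow]
    rw [← Finset.sum_div]
    field_simp
    linarith
  refine ⟨⟨z, hz⟩, unitSphere_ext ?_ fun j => ?_, fun k hk => by simp [z, hk]⟩
  · rw [collapse_zero, hS]
    simp only [z, Pi.single_eq_same]
    field_simp
    ring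
  · rw [collapse_succ, hS]
    simp only [z, Pi.single_eq_same]
    field_simp

/-- The deformation of `tripleBall n` shrinking the cross-polytope with index `2` to its centre,
before rescaling the sum of the absolute values of the coordinates to `1`. -/
def shrinkVec {n : ℕ} (s : ℝ) (z : (Fin n → ℝ) × (Fin 3 → ℝ)) :
    (Fin n → ℝ) × (Fin 3 → ℝ) :=
  -- The last coordinates push the common boundary into ball 2, dragging along collars in balls 0
  -- and 1. On ball 2 the factor of `y` is `1 - s`, which vanishes at time 1.
  (((1 - s) + s * (z.2 0 + z.2 1)) • z.1,
    ![max 0 (z.2 0 - s * ∑ j, |z.1 j|), max 0 (z.2 1 - s * ∑ j, |z.1 j|),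
      z.2 2 + max 0 (s * (∑ j, |z.1 j|) - z.2 0 - z.2 1)])

/-- The sum of the absolute values of the coordinates. -/
def absSum {n : ℕ} (z : (Fin n → ℝ) × (Fin 3 → ℝ)) : ℝ := ∑ j, |z.1 j| + ∑ i, z.2 i

theorem shrinkVec_nonneg {n : ℕ} {s : ℝ} {z : (Fin n → ℝ) × (Fin 3 → ℝ)}
    (hz : z ∈ tripleBall n) (i : Fin 3) : 0 ≤ (shrinkVec s z).2 i := by
  have := hz.1 2
  fin_cases i <;> simp [shrinkVec]
  positivity

theorem absSum_shrinkVec_pos {n : ℕ} {s : ℝ} (hs0 : 0 ≤ s) (hs1 : s ≤ 1)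
    {z : (Fin n → ℝ) × (Fin 3 → ℝ)} (hz : z ∈ tripleBall n) : 0 < absSum (shrinkVec s z) := by
  have h0 := hz.1 0
  have h1 := hz.1 1
  have h2 := hz.1 2
  have hsum := hz.2.2
  rw [Fin.sum_univ_three] at hsum
  have hρ : 0 ≤ ∑ j, |z.1 j| := Finset.sum_nonneg fun _ _ => abs_nonneg _
  have hg : 0 ≤ (1 - s) + s * (z.2 0 + z.2 1) :=
    add_nonneg (by linarith) (mul_nonneg hs0 (by linarith))
  have hval : absSum (shrinkVec s z) = ((1 - s) + s * (z.2 0 + z.2 1)) * (∑ j, |z.1 j|) +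
      (max 0 (z.2 0 - s * ∑ j, |z.1 j|) + max 0 (z.2 1 - s * ∑ j, |z.1 j|) +
        (z.2 2 + max 0 (s * (∑ j, |z.1 j|) - z.2 0 - z.2 1))) := by
    simp only [absSum, shrinkVec, Fin.sum_univ_three, Pi.smul_apply, smul_eq_mul, abs_mul,
      abs_of_nonneg hg, ← Finset.mul_sum]
    rfl
  rw [hval]
  generalize (∑ j, |z.1 j|) = ρ at *
  have hgρ := mul_nonneg hg hρ
  have m1 := le_max_left 0 (z.2 0 - s * ρ)
  have m2 := le_max_left 0 (z.2 1 - s * ρ)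
  have m3 := le_max_left 0 (s * ρ - z.2 0 - z.2 1)
  have m1' := le_max_right 0 (z.2 0 - s * ρ)
  have m2' := le_max_right 0 (z.2 1 - s * ρ)
  have m3' := le_max_right 0 (s * ρ - z.2 0 - z.2 1)
  by_contra hneg
  have hg0 : ((1 - s) + s * (z.2 0 + z.2 1)) * ρ = 0 := by linarith
  rcases mul_eq_zero.mp hg0 with h | h
  -- A zero factor forces `s = 1` and `t 0 + t 1 = 0`; then the last coordinate is at least `t 2 + ρ
  -- = 1`.
  · have hst : 0 ≤ s * (z.2 0 + z.2 1) := mul_nonneg hs0 (by linarith)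
    obtain rfl : s = 1 := by linarith
    linarith
  · subst h
    linarith

theorem shrinkVec_mul_eq_zero {n : ℕ} {s : ℝ} (hs0 : 0 ≤ s)
    {z : (Fin n → ℝ) × (Fin 3 → ℝ)} (hz : z ∈ tripleBall n) (i j : Fin 3) (hij : i ≠ j) :
    (shrinkVec s z).2 i * (shrinkVec s z).2 j = 0 := by
  have hρ : 0 ≤ s * ∑ j, |z.1 j| :=
    mul_nonneg hs0 (Finset.sum_nonneg fun _ _ => abs_nonneg _)
  have h0 := hz.1 0
  have h1 := hz.1 1
  have h01 := hz.2.1 0 1 (by decide)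
  have h02 := hz.2.1 0 2 (by decide)
  have h12 := hz.2.1 1 2 (by decide)
  have e0 : (shrinkVec s z).2 0 = max 0 (z.2 0 - s * ∑ j, |z.1 j|) := rfl
  have e1 : (shrinkVec s z).2 1 = max 0 (z.2 1 - s * ∑ j, |z.1 j|) := rfl
  have e2 : (shrinkVec s z).2 2 = z.2 2 + max 0 (s * (∑ j, |z.1 j|) - z.2 0 - z.2 1) := rfl
  generalize s * ∑ j, |z.1 j| = u at *
  have key : ∀ a b c : ℝ, 0 ≤ b → a * c = 0 →
      max 0 (a - u) * (c + max 0 (u - a - b)) = 0 := by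
    intro a b c hb hac
    rcases le_total a u with h | h
    · rw [max_eq_left (by linarith), zero_mul]
    · rcases mul_eq_zero.mp hac with rfl | rfl
      · rw [max_eq_left (by linarith), zero_mul]
      · rw [max_eq_left (a := 0) (b := u - a - b) (by linarith)]; simp
  have p01 : (shrinkVec s z).2 0 * (shrinkVec s z).2 1 = 0 := by
    rw [e0, e1]
    rcases mul_eq_zero.mp h01 with h | h
    · rw [h, max_eq_left (by linarith), zero_mul]
    · rw [h, max_eq_left (a := 0) (b := 0 - u) (by linarith), mul_zero]
  have p02 : (shrinkVec s z).2 0 * (shrinkVec s z).2 2 = 0 := by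
    rw [e0, e2]; exact key _ _ _ h1 h02
  have p12 : (shrinkVec s z).2 1 * (shrinkVec s z).2 2 = 0 := by
    rw [e1, e2, sub_right_comm]; exact key _ _ _ h0 h12
  fin_cases i <;> fin_cases j <;> first
    | exact absurd rfl hij
    | assumption
    | (rw [mul_comm]; assumption)

theorem inv_absSum_smul_mem_tripleBall {n : ℕ} {z : (Fin n → ℝ) × (Fin 3 → ℝ)}
    (h0 : ∀ i, 0 ≤ z.2 i) (h1 : ∀ i j, i ≠ j → z.2 i * z.2 j = 0) (h2 : 0 < absSum z) :
    (absSum z)⁻¹ • z ∈ tripleBall n := by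
  refine ⟨fun i => mul_nonneg (inv_nonneg.2 h2.le) (h0 i), fun i j hij => ?_, ?_⟩
  · simp only [Prod.smul_snd, Pi.smul_apply, smul_eq_mul]
    linear_combination (absSum z)⁻¹ * (absSum z)⁻¹ * h1 i j hij
  · simp only [Prod.smul_snd, Prod.smul_fst, Pi.smul_apply, smul_eq_mul, abs_mul, abs_inv,
      abs_of_pos h2, ← Finset.mul_sum, ← mul_add]
    exact inv_mul_cancel₀ h2.ne'

/-- The homotopy shrinking the cross-polytope with index `2` of `tripleBall n` to its centre. -/
noncomputable def shrink (n : ℕ) : C(I × tripleBall n, tripleBall n) where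
  toFun p := ⟨(absSum (shrinkVec (p.1 : ℝ) p.2.1))⁻¹ • shrinkVec (p.1 : ℝ) p.2.1,
    inv_absSum_smul_mem_tripleBall (shrinkVec_nonneg p.2.2)
      (shrinkVec_mul_eq_zero p.1.2.1 p.2.2) (absSum_shrinkVec_pos p.1.2.1 p.1.2.2 p.2.2)⟩
  continuous_toFun := by
    have h1 : Continuous fun p : I × tripleBall n => shrinkVec (p.1 : ℝ) p.2.1 := by
      unfold shrinkVec
      refine Continuous.prodMk (by fun_prop) (continuous_pi fun i => ?_)
      fin_cases i
      · exact continuous_const.max (by fun_prop)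
      · exact continuous_const.max (by fun_prop)
      · exact Continuous.add (by fun_prop) (continuous_const.max (by fun_prop))
    have h2 : Continuous (absSum : (Fin n → ℝ) × (Fin 3 → ℝ) → ℝ) := by
      unfold absSum
      fun_prop
    exact (((h2.comp h1).inv₀ fun p =>
      (absSum_shrinkVec_pos p.1.2.1 p.1.2.2 p.2.2).ne').smul h1).subtype_mk _

theorem shrink_zero {n : ℕ} (z : tripleBall n) : shrink n (0, z) = z := by
  have h : shrinkVec 0 z.1 = z.1 := by
    refine Prod.ext (by simp [shrinkVec]) (funext fun i => ?_)
    have h0 := z.2.1 0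
    have h1 := z.2.1 1
    fin_cases i <;> simp [shrinkVec]
    · exact h0
    · exact h1
    · linarith
  refine Subtype.ext ?_
  change (absSum (shrinkVec 0 z.1))⁻¹ • shrinkVec 0 z.1 = z.1
  rw [h, absSum, z.2.2.2]
  simp

/-- Ball 2 is preserved at all times, which lets the homotopy descend to the quotient. -/
theorem shrink_eq_zero {n : ℕ} (s : I) {z : tripleBall n} (h0 : z.1.2 0 = 0)
    (h1 : z.1.2 1 = 0) : (shrink n (s, z)).1.2 0 = 0 ∧ (shrink n (s, z)).1.2 1 = 0 := by
  have hρ : 0 ≤ (s : ℝ) * ∑ j, |z.1.1 j| :=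
    mul_nonneg s.2.1 (Finset.sum_nonneg fun _ _ => abs_nonneg _)
  constructor
  · change _ * max 0 (z.1.2 0 - (s : ℝ) * ∑ j, |z.1.1 j|) = 0
    rw [h0, max_eq_left (by linarith), mul_zero]
  · change _ * max 0 (z.1.2 1 - (s : ℝ) * ∑ j, |z.1.1 j|) = 0
    rw [h1, max_eq_left (by linarith), mul_zero]

theorem shrink_one_fst {n : ℕ} {z : tripleBall n} (h0 : z.1.2 0 = 0) (h1 : z.1.2 1 = 0) :
    (shrink n (1, z)).1.1 = 0 := by
  change _ • (((1 - ((1 : I) : ℝ)) + ((1 : I) : ℝ) * (z.1.2 0 + z.1.2 1)) • z.1.1) = 0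
  simp [h0, h1]

/-- At time 1 ball 2 has become its centre, so the end map factors through the collapse. -/
theorem shrink_one_eq {n : ℕ} {z z' : tripleBall n} (h0 : z.1.2 0 = 0) (h1 : z.1.2 1 = 0)
    (h0' : z'.1.2 0 = 0) (h1' : z'.1.2 1 = 0) : shrink n (1, z) = shrink n (1, z') := by
  have key : ∀ z : tripleBall n, z.1.2 0 = 0 → z.1.2 1 = 0 → (shrink n (1, z)).1.2 2 = 1 := by
    intro z h0 h1
    have h := (shrink n (1, z)).2.2.2
    rw [Fin.sum_univ_three, (shrink_eq_zero 1 h0 h1).1, (shrink_eq_zero 1 h0 h1).2,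
      shrink_one_fst h0 h1] at h
    simpa using h
  refine Subtype.ext (Prod.ext ?_ (funext fun i => ?_))
  · rw [shrink_one_fst h0 h1, shrink_one_fst h0' h1']
  · fin_cases i
    · exact (shrink_eq_zero 1 h0 h1).1.trans (shrink_eq_zero 1 h0' h1').1.symm
    · exact (shrink_eq_zero 1 h0 h1).2.trans (shrink_eq_zero 1 h0' h1').2.symm
    · exact (key z h0 h1).trans (key z' h0' h1').symm

theorem nonempty_homotopyEquiv_tripleBall_wedgeSum (n : ℕ) :
    Nonempty (ContinuousMap.HomotopyEquiv (tripleBall n)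
      (WedgeSum (unitSphere n) (unitSphere n) (unitSphere.base n) (unitSphere.base n))) := by
  have := isCompact_iff_compactSpace.mp (isCompact_tripleBall n)
  obtain ⟨e⟩ := nonempty_wedgeSum_homeomorph (unitSphere.base n) (unitSphere.base n)
  have hmem : ∀ z : tripleBall n, collapse 0 z = unitSphere.base n ∨
      collapse 1 z = unitSphere.base n := fun z => by
    simp only [collapse_eq_base_iff]
    exact mul_eq_zero.mp (z.2.2.1 0 1 (by decide))
  let f : C(tripleBall n, {p : unitSphere n × unitSphere n |
      p.1 = unitSphere.base n ∨ p.2 = unitSphere.base n}) :=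
    ⟨fun z => ⟨(collapse 0 z, collapse 1 z), hmem z⟩,
      ((continuous_collapse 0).prodMk (continuous_collapse 1)).subtype_mk hmem⟩
  -- The only nontrivial fibre of `f` is ball 2.
  have hfib : ∀ z z', f z = f z' → z = z' ∨
      (z.1.2 0 = 0 ∧ z.1.2 1 = 0 ∧ z'.1.2 0 = 0 ∧ z'.1.2 1 = 0) := by
    intro z z' h
    have h0 : collapse 0 z = collapse 0 z' := congrArg (fun p => p.1.1) h
    have h1 : collapse 1 z = collapse 1 z' := congrArg (fun p => p.1.2) h
    by_cases hz0 : z.1.2 0 = 0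
    · by_cases hz1 : z.1.2 1 = 0
      · refine Or.inr ⟨hz0, hz1, ?_, ?_⟩
        · rwa [← collapse_eq_base_iff, ← h0, collapse_eq_base_iff]
        · rwa [← collapse_eq_base_iff, ← h1, collapse_eq_base_iff]
      · exact Or.inl (eq_of_collapse_eq 1 h1 hz1)
    · exact Or.inl (eq_of_collapse_eq 0 h0 hz0)
  have hbase : ∀ z : tripleBall n, z.1.2 0 = 0 → z.1.2 1 = 0 →
      f z = ⟨(unitSphere.base n, unitSphere.base n), Or.inl rfl⟩ := by
    intro z h0 h1
    exact Subtype.ext (Prod.ext ((collapse_eq_base_iff 0 z).2 h0) ((collapse_eq_base_iff 1 z).2 h1))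
  have hsurj : Function.Surjective f := by
    rintro ⟨⟨p, q⟩, h⟩
    by_cases hp : p = unitSphere.base n
    · by_cases hq : q = unitSphere.base n
      · refine ⟨⟨(0, Pi.single 2 1), ?_, ?_, ?_⟩, ?_⟩
        · intro i
          fin_cases i <;> simp
        · intro i j hij
          fin_cases i <;> fin_cases j <;> simp at hij ⊢
        · simp
        · rw [hbase _ (by simp) (by simp)]
          exact Subtype.ext (Prod.ext hp.symm hq.symm)
      · obtain ⟨z, hz, hk⟩ := exists_collapse_eq 1 hq
        exact ⟨z, Subtype.ext (Prod.ext
          (((collapse_eq_base_iff 0 z).2 (hk 0 (by decide))).trans hp.symm) hz)⟩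
    · obtain ⟨z, hz, hk⟩ := exists_collapse_eq 0 hp
      exact ⟨z, Subtype.ext (Prod.ext hz
        (((collapse_eq_base_iff 1 z).2 (hk 1 (by decide))).trans (h.resolve_left hp).symm))⟩
  obtain ⟨e'⟩ := nonempty_homotopyEquiv_of_compatible_homotopy f hsurj (shrink n) shrink_zero
    (fun z z' h => by
      rcases hfib z z' h with rfl | ⟨h0, h1, h0', h1'⟩
      · rfl
      · exact shrink_one_eq h0 h1 h0' h1')
    (fun s z z' h => by
      rcases hfib z z' h with rfl | ⟨h0, h1, h0', h1'⟩
      · rfl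
      · rw [hbase _ (shrink_eq_zero s h0 h1).1 (shrink_eq_zero s h0 h1).2,
          hbase _ (shrink_eq_zero s h0' h1').1 (shrink_eq_zero s h0' h1').2])
  exact ⟨e'.trans e.symm.toHomotopyEquiv⟩

/-! ### The complex of a triangle and `n` edges as three glued balls -/

theorem sum_fin_two_mul_add_one (n : ℕ) (g : ℕ → ℝ) :
    ∑ r : Fin (2 * n + 1), g r = g 0 + ∑ j : Fin n, (g (2 * j + 1) + g (2 * j + 2)) := by
  rw [Fin.sum_univ_eq_sum_range, Fin.sum_univ_eq_sum_range (fun j => g (2 * j + 1) + g (2 * j + 2))]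
  induction n with
  | zero => simp
  | succ n ih =>
    rw [Finset.sum_range_succ _ n, ← add_assoc, ← ih, show 2 * (n + 1) + 1 = 2 * n + 1 + 1 + 1 by ring,
      Finset.sum_range_succ, Finset.sum_range_succ, add_assoc]

/-- The coordinate of the point of `ℝ ^ (Fin 2 × Fin (2 * n + 1))` with signed rung coordinates
`z.1` and triangle coordinates `z.2`. -/
def gridCoord {n : ℕ} (z : (Fin n → ℝ) × (Fin 3 → ℝ)) (i r : ℕ) : ℝ :=
  if r = 0 then (if i = 0 then z.2 0 else z.2 1)
  else if r % 2 = 1 then (if i = 0 ∧ r = 1 then z.2 2 else 0)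
  else if h : r / 2 - 1 < n then
    (if i = 0 then max (z.1 ⟨r / 2 - 1, h⟩) 0 else max (-z.1 ⟨r / 2 - 1, h⟩) 0)
  else 0

theorem gridCoord_rung {n : ℕ} (z : (Fin n → ℝ) × (Fin 3 → ℝ)) (i : ℕ) (j : Fin n) :
    gridCoord z i (2 * j + 2) = if i = 0 then max (z.1 j) 0 else max (-z.1 j) 0 := by
  have h1 : (2 * (j : ℕ) + 2) % 2 = 0 := by omega
  simp [gridCoord, h1]

theorem gridCoord_odd {n : ℕ} (z : (Fin n → ℝ) × (Fin 3 → ℝ)) (i j : ℕ) :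
    gridCoord z i (2 * j + 1) = if i = 0 ∧ j = 0 then z.2 2 else 0 := by
  have h1 : (2 * j + 1) % 2 = 1 := by omega
  simp [gridCoord, h1]

theorem continuous_gridCoord {n : ℕ} (i r : ℕ) :
    Continuous fun z : (Fin n → ℝ) × (Fin 3 → ℝ) => gridCoord z i r := by
  unfold gridCoord
  split_ifs <;> fun_prop

theorem sum_gridCoord {n : ℕ} (hn : 1 ≤ n) (z : (Fin n → ℝ) × (Fin 3 → ℝ)) :
    ∑ v : Fin 2 × Fin (2 * n + 1), gridCoord z v.1 v.2 = ∑ j, |z.1 j| + ∑ i, z.2 i := by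
  rw [Fintype.sum_prod_type, Fin.sum_univ_two]
  dsimp only
  rw [sum_fin_two_mul_add_one n (gridCoord z _), sum_fin_two_mul_add_one n (gridCoord z _)]
  have hodd : ∑ j : Fin n, (if (j : ℕ) = 0 then z.2 2 else 0) = z.2 2 := by
    rw [Finset.sum_eq_single ⟨0, hn⟩ (fun j _ hj => if_neg fun h => hj (Fin.ext h)) (by simp)]
    simp
  have habs : ∀ j, |z.1 j| = max (z.1 j) 0 + max (-z.1 j) 0 := by
    intro j
    rcases le_total 0 (z.1 j) with h | h
    · rw [abs_of_nonneg h, max_eq_left h, max_eq_right (by linarith), add_zero]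
    · rw [abs_of_nonpos h, max_eq_right h, max_eq_left (by linarith), zero_add]
  simp only [gridCoord_rung, gridCoord_odd, Finset.sum_add_distrib]
  simp only [habs, Finset.sum_add_distrib, Fin.sum_univ_three]
  simp [gridCoord, hodd]
  ring

theorem gridCoord_mem_indepSpace {n : ℕ} (hn : 1 ≤ n) {z : (Fin n → ℝ) × (Fin 3 → ℝ)}
    (hz : z ∈ tripleBall n) :
    (fun v : Fin 2 × Fin (2 * n + 1) => gridCoord z v.1 v.2) ∈
      indepSpace (gridRel (2 * n + 1) (triangleTiling 0)) := by
  obtain ⟨h1, h2, h3⟩ := hz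
  refine ⟨⟨fun v => ?_, ?_⟩, ?_⟩
  · simp only [gridCoord]
    split_ifs <;> first | exact h1 _ | exact le_rfl | exact le_max_right _ _
  · rw [sum_gridCoord hn, h3]
  · have hrung : ∀ j : Fin n, max (z.1 j) 0 * max (-z.1 j) 0 = 0 := by
      intro j
      rcases le_total 0 (z.1 j) with h | h
      · rw [max_eq_right (a := -z.1 j) (by linarith), mul_zero]
      · rw [max_eq_right h, zero_mul]
    have h01 := h2 0 1 (by decide)
    have h02 := h2 0 2 (by decide)
    have h12 := h2 1 2 (by decide)
    rintro ⟨⟨i, hi⟩, ⟨p, hp⟩⟩ ⟨⟨j, hj⟩, ⟨q, hq⟩⟩ hab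
    have hodd : ∀ i p, p % 2 = 1 → ¬ (i = 0 ∧ p = 1) → gridCoord z i p = 0 := by
      intro i p h h'
      have : p ≠ 0 := by omega
      simp [gridCoord, h, h', this]
    by_cases ha : p % 2 = 1 ∧ ¬ (i = 0 ∧ p = 1)
    · simp only [hodd i p ha.1 ha.2, zero_mul]
    by_cases hb : q % 2 = 1 ∧ ¬ (j = 0 ∧ q = 1)
    · simp only [hodd j q hb.1 hb.2, mul_zero]
    have hcases : (p = q ∧ i ≠ j ∧ p % 2 = 0) ∨ (p = 0 ∧ q = 1) ∨ (p = 1 ∧ q = 0) := by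
      simp only [gridRel, triangleTiling, partialTiling] at hab
      grind
    have e0 : gridCoord z 0 0 = z.2 0 := rfl
    have e1 : gridCoord z 1 0 = z.2 1 := rfl
    have e2 : gridCoord z 0 1 = z.2 2 := rfl
    rcases hcases with ⟨rfl, hij, hpar⟩ | ⟨rfl, rfl⟩ | ⟨rfl, rfl⟩
    · have hij : (i = 0 ∧ j = 1) ∨ (i = 1 ∧ j = 0) := by omega
      rcases Nat.eq_zero_or_pos p with rfl | hpos
      · rcases hij with ⟨rfl, rfl⟩ | ⟨rfl, rfl⟩
        · exact h01
        · rw [mul_comm]; exact h01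
      · obtain ⟨k, rfl⟩ : ∃ k : Fin n, p = 2 * k + 2 := ⟨⟨p / 2 - 1, by omega⟩, by simp only; omega⟩
        rcases hij with ⟨rfl, rfl⟩ | ⟨rfl, rfl⟩
        · simpa [gridCoord_rung] using hrung k
        · rw [mul_comm]; simpa [gridCoord_rung] using hrung k
    · obtain rfl : j = 0 := by omega
      rcases (by omega : i = 0 ∨ i = 1) with rfl | rfl
      · exact h02
      · exact h12
    · obtain rfl : i = 0 := by omega
      rcases (by omega : j = 0 ∨ j = 1) with rfl | rfl
      · rw [mul_comm]; exact h02
      · rw [mul_comm]; exact h12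

/-- The signed rung coordinates and the triangle coordinates of a point. -/
def signedCoord {n : ℕ} (hn : 1 ≤ n) (x : Fin 2 × Fin (2 * n + 1) → ℝ) :
    (Fin n → ℝ) × (Fin 3 → ℝ) :=
  (fun j => x (0, ⟨2 * j + 2, by omega⟩) - x (1, ⟨2 * j + 2, by omega⟩),
    ![x (0, ⟨0, by omega⟩), x (1, ⟨0, by omega⟩), x (0, ⟨1, by omega⟩)])

theorem continuous_signedCoord {n : ℕ} (hn : 1 ≤ n) : Continuous (signedCoord hn) := by
  unfold signedCoord
  refine Continuous.prodMk (by fun_prop) (continuous_pi fun i => ?_)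
  fin_cases i <;> exact continuous_apply _

theorem signedCoord_gridCoord {n : ℕ} (hn : 1 ≤ n) (z : (Fin n → ℝ) × (Fin 3 → ℝ)) :
    signedCoord hn (fun v => gridCoord z v.1 v.2) = z := by
  refine Prod.ext (funext fun j => ?_) (funext fun i => ?_)
  · simp only [signedCoord, gridCoord_rung]
    rcases le_total 0 (z.1 j) with h | h
    · simp [h]
    · simp [h]
  · fin_cases i <;> rfl

/-- On an isolated rung one of the two nonnegative coordinates vanishes, so they are the positive
and negative parts of their difference. -/
theorem gridCoord_signedCoord {n : ℕ} (hn : 1 ≤ n) {x : Fin 2 × Fin (2 * n + 1) → ℝ}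
    (hx : x ∈ indepSpace (gridRel (2 * n + 1) (triangleTiling 0))) (v : Fin 2 × Fin (2 * n + 1)) :
    gridCoord (signedCoord hn x) v.1 v.2 = x v := by
  obtain ⟨⟨h0, -⟩, h⟩ := hx
  obtain ⟨⟨i, hi⟩, ⟨p, hp⟩⟩ := v
  rcases Nat.eq_zero_or_pos p with rfl | hpos
  · rcases (by omega : i = 0 ∨ i = 1) with rfl | rfl <;> rfl
  rcases Nat.even_or_odd' p with ⟨k, rfl | rfl⟩
  · obtain ⟨j, rfl⟩ : ∃ j : Fin n, k = j + 1 := ⟨⟨k - 1, by omega⟩, by simp only; omega⟩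
    have hz := h (0, ⟨2 * j + 2, by omega⟩) (1, ⟨2 * j + 2, by omega⟩) (by
      simp [gridRel, triangleTiling, partialTiling])
    have ha := h0 (0, ⟨2 * j + 2, by omega⟩)
    have hb := h0 (1, ⟨2 * j + 2, by omega⟩)
    change gridCoord (signedCoord hn x) i (2 * j + 2) = _
    rw [gridCoord_rung]
    rcases (by omega : i = 0 ∨ i = 1) with rfl | rfl
    · change max (_ - _) 0 = x (0, ⟨2 * j + 2, by omega⟩)
      rcases mul_eq_zero.mp hz with hz | hz <;> rw [hz] at * <;> simpa using by assumption
    · change max (-(_ - _)) 0 = x (1, ⟨2 * j + 2, by omega⟩)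
      rcases mul_eq_zero.mp hz with hz | hz <;> rw [hz] at * <;> simpa using by assumption
  · simp only [gridCoord_odd]
    by_cases hik : i = 0 ∧ k = 0
    · obtain ⟨rfl, rfl⟩ := hik
      rfl
    · rw [if_neg hik]
      refine (mul_self_eq_zero.mp (h _ _ ?_)).symm
      simp only [gridRel, triangleTiling, partialTiling]
      grind

theorem signedCoord_mem_tripleBall {n : ℕ} (hn : 1 ≤ n) {x : Fin 2 × Fin (2 * n + 1) → ℝ}
    (hx : x ∈ indepSpace (gridRel (2 * n + 1) (triangleTiling 0))) :
    signedCoord hn x ∈ tripleBall n := by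
  have hgrid := gridCoord_signedCoord hn hx
  obtain ⟨⟨h0, hsum⟩, h⟩ := hx
  have h01 := h (0, ⟨0, by omega⟩) (1, ⟨0, by omega⟩) (by
    simp [gridRel, triangleTiling, partialTiling])
  have h02 := h (0, ⟨0, by omega⟩) (0, ⟨1, by omega⟩) (by
    simp [gridRel, triangleTiling, partialTiling])
  have h12 := h (1, ⟨0, by omega⟩) (0, ⟨1, by omega⟩) (by
    simp [gridRel, triangleTiling, partialTiling])
  refine ⟨fun i => ?_, fun i j hij => ?_, ?_⟩
  · fin_cases i <;> exact h0 _
  · fin_cases i <;> fin_cases j <;> first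
      | exact absurd rfl hij
      | assumption
      | (rw [mul_comm]; assumption)
  · rw [← hsum, ← sum_gridCoord hn]
    simp only [hgrid]

/-- The independence complex of the disjoint union of a triangle and `n` edges is `tripleBall n`. -/
noncomputable def indepSpaceHomeomorphTripleBall {n : ℕ} (hn : 1 ≤ n) :
    indepSpace (gridRel (2 * n + 1) (triangleTiling 0)) ≃ₜ tripleBall n where
  toFun x := ⟨signedCoord hn x, signedCoord_mem_tripleBall hn x.2⟩
  invFun z := ⟨fun v => gridCoord z.1 v.1 v.2, gridCoord_mem_indepSpace hn z.2⟩
  left_inv x := Subtype.ext (funext (gridCoord_signedCoord hn x.2))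
  right_inv z := Subtype.ext (signedCoord_gridCoord hn z.1)
  continuous_toFun := ((continuous_signedCoord hn).comp continuous_subtype_val).subtype_mk _
  continuous_invFun := (continuous_pi fun _ =>
    (continuous_gridCoord _ _).comp continuous_subtype_val).subtype_mk _

/-- For every `n ≥ 1`, the independence complex of `H_{1 × 1 × n}` is homotopy equivalent to
`S^n ∨ S^n`. -/
theorem mainTheorem1 (n : ℕ) (hn : 1 ≤ n) :
    Nonempty (ContinuousMap.HomotopyEquiv
      (geomRealization (indComplex (hexLineTiling n)))
      (WedgeSum (unitSphere n) (unitSphere n) (unitSphere.base n) (unitSphere.base n))) := by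
  rw [geomRealization_indComplex, hexLineTiling_adj_eq]
  obtain ⟨k, rfl⟩ : ∃ k, n = k + 1 := ⟨n - 1, by omega⟩
  obtain ⟨e₁⟩ := nonempty_homotopyEquiv_partialTiling_triangleTiling_zero
    (m := 2 * (k + 1) + 1) k (by omega)
  obtain ⟨e₂⟩ := nonempty_homotopyEquiv_tripleBall_wedgeSum (k + 1)
  exact ⟨(e₁.trans (indepSpaceHomeomorphTripleBall hn).toHomotopyEquiv).trans e₂⟩
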